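/- Let $n,d\ge 1$ and let $F_1,\dots,F_d\in\mathbb C^{n\times n}$ be the Kraus operators of a quantum channel $\mathcal F(\rho)=\sum_{j=1}^d F_j\rho F_j^\dagger$, so that $\sum_{j=1}^d F_j^\dagger F_j=I$. For a unitary matrix $U\in\mathbb C^{r\times r}$ with eigenvalues $e^{-i\theta_1},\dots,e^{-i\theta_r}$, $\theta_j\in(-\pi,\pi]$, put $\|U\|_{\max}=\max_{1\le j\le r}|\theta_j|$. For $G\in\mathbb C^{r\times n}$ with orthonormal columns, let $\|G\|_{\max}$ be the minimum of $\|V\|_{\max}$ over all unitary $V\in\mathbb C^{r\times r}$ whose first $n$ columns form $G$. The max time-energy of $\mathcal F$ is $$\|\mathcal F\|_{\max}=\inf_{d',\,W}\ \left\|(W\otimes I_n)\begin{bmatrix}F_1\\ \vdots\\ F_d\\ 0\\ \vdots\\ 0\end{bmatrix}\right\|_{\max},$$ where $d'$ ranges over the integers with $d\le d'<\infty$, $W$ over the unitary $d'\times d'$ matrices, and the block column consists of $d'$ blocks of size $n\times n$, the last $d'-d$ of which are zero. Then $$\|\mathcal F\|_{\max}\ \le\ \min_{v\in\mathbb C^d,\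 \|v\|\le 1}\ \sum_{i=1}^n\arccos\Big(\operatorname{Re}\,\lambda_i\Big(\sum_{j=1}^d v_jF_j\Big)\Big),$$ where $\|v\|=\big(\sum_{j=1}^d|v_j|^2\big)^{1/2}$, $\lambda_1(M),\dots,\lambda_n(M)$ are the eigenvalues of $M$ counted with algebraic multiplicity, $\arccos$ takes values in $[0,\pi]$, and the minimum on the right-hand side is attained. -/

import Mathlib

open scoped Kronecker

namespace TimeEnergy

/-- The eigenangles of `U`: the angles `θ ∈ (-π, π]` such that `exp (-i θ)` is an eigenvalue of `U`
(as a set; multiplicities are irrelevant for the maximum below). -/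
def eigenangles {R : Type*} [Fintype R] [DecidableEq R] (U : Matrix R R ℂ) : Set ℝ :=
  {θ | θ ∈ Set.Ioc (-Real.pi) Real.pi ∧
    Module.End.HasEigenvalue (Matrix.toLin' U) (Complex.exp (-(Complex.I * (θ : ℂ))))}

/-- The max time-energy `‖U‖_max` of a unitary matrix: the largest absolute value of an eigenangle
(the set is finite, and it is nonempty for a unitary matrix of positive size). -/
noncomputable def unitaryMaxNorm {R : Type*} [Fintype R] [DecidableEq R]
    (U : Matrix R R ℂ) : ℝ :=
  sSup ((fun θ : ℝ => |θ|) '' eigenangles U)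

/-- The partial `U` problem: the least max time-energy of a unitary matrix `V` whose columns
at the positions `c` are those of `G`. -/
noncomputable def partialMaxNorm {R K : Type*} [Fintype R] [DecidableEq R]
    (c : K → R) (G : Matrix R K ℂ) : ℝ :=
  sInf {x : ℝ | ∃ V ∈ Matrix.unitaryGroup R ℂ, V.submatrix id c = G ∧ unitaryMaxNorm V = x}

/-- `F_1, …, F_d` are the Kraus operators of a (trace-preserving) channel: `∑ F_j† F_j = I`. -/
def IsKraus {n d : ℕ} (F : Fin d → Matrix (Fin n) (Fin n) ℂ) : Prop :=
  ∑ j, (F j).conjTranspose * F j = 1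

/-- The block column `F_1, …, F_d, 0, …, 0` with `d'` blocks; the row index `(i, a)` is row `a` of
block `i`. -/
def stack {n d : ℕ} (d' : ℕ) (F : Fin d → Matrix (Fin n) (Fin n) ℂ) :
    Matrix (Fin d' × Fin n) (Fin n) ℂ :=
  fun p k => if h : p.1.val < d then F ⟨p.1.val, h⟩ p.2 k else 0

/-- The channel problem: the max time-energy of the channel with Kraus operators `F_1, …, F_d`,
minimized over the dimension `d' = m + 1 ≥ d` of the ancilla `B` and the unitary `W` on `B`. The
first `n` columns of a matrix on `B ⊗ A` are the columns `(0, k)`. -/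
noncomputable def channelMaxNorm {n d : ℕ} (F : Fin d → Matrix (Fin n) (Fin n) ℂ) : ℝ :=
  sInf {x : ℝ | ∃ m : ℕ, d ≤ m + 1 ∧ ∃ W ∈ Matrix.unitaryGroup (Fin (m + 1)) ℂ,
    partialMaxNorm (fun k : Fin n => ((0 : Fin (m + 1)), k))
      ((W ⊗ₖ (1 : Matrix (Fin n) (Fin n) ℂ)) * stack (m + 1) F) = x}

/-- `∑ i, arccos (Re (λ_i M))` over the eigenvalues of `M`, with algebraic multiplicity. -/
noncomputable def sumArccosEigenvalues {n : ℕ} (M : Matrix (Fin n) (Fin n) ℂ) : ℝ :=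
  (M.charpoly.roots.map (fun z : ℂ => Real.arccos z.re)).sum

end TimeEnergy

/-! Given `v` in the unit ball, one extra zero block leaves room to extend `v` to a unit vector.
Taking this as the first row of `W` makes `M = ∑ v_j F_j` the top block of the isometry `G = (W ⊗ I)
stack`. Choose a Schur basis `Q` of `M`. With `J` the embedding onto the first block, the columns
`u_i` of `J Q` and `g_i` of `G Q` satisfy `⟪u_i, g_j⟫ = (Q† M Q)_ij`, which vanishes for `j < i`.
Rotate each `u_i` to `g_i` in the plane they span (`exists_rotation`). Triangularity keeps the
rotations from disturbing one another, so their composite completes `G`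
(`exists_isometry_of_triangular`). The `i`-th rotation turns no vector by more than `arccos (Re
λ_i)`. By the triangle inequality for angles the composite turns none by more than the sum, and an
eigenvector for `exp (-iθ)` is turned by exactly `|θ|`. -/

open scoped ComplexConjugate InnerProductSpace

namespace TimeEnergy

/-! ### Plane rotations, their composition, and Schur bases -/

section Rotation

variable {E : Type*} [NormedAddCommGroup E] [InnerProductSpace ℂ E]

/-- The angle between two vectors for the real inner product `Re ⟪x, y⟫_ℂ`. -/
noncomputable def realAngle (x y : E) : ℝ := Real.arccos ((⟪x, y⟫_ℂ).re / (‖x‖ * ‖y‖))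

lemma realAngle_self {x : E} (hx : x ≠ 0) : realAngle x x = 0 := by
  have h : (⟪x, x⟫_ℂ).re = ‖x‖ * ‖x‖ := (inner_self_eq_norm_mul_norm (𝕜 := ℂ) x)
  rw [realAngle, h, div_self (by simpa using hx), Real.arccos_one]

lemma realAngle_le_add (x y z : E) : realAngle x z ≤ realAngle x y + realAngle y z := by
  -- For the underlying real inner product, `realAngle` is the usual angle by definition.
  let := InnerProductSpace.complexToReal (G := E)
  exact InnerProductGeometry.angle_le_angle_add_angle x y z

/-- The component of a unit vector `g` orthogonal to a unit vector `u`, normalised when nonzero. -/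
lemma exists_orthogonal_decomposition (u g : E) (hu : ‖u‖ = 1) (hg : ‖g‖ = 1) :
    ∃ (w : E) (β e : ℂ), g = ⟪u, g⟫_ℂ • u + β • w ∧ ⟪u, w⟫_ℂ = 0 ∧ ⟪w, w⟫_ℂ = e ∧
      β * e = β ∧ (∀ x, e * ⟪w, x⟫_ℂ = ⟪w, x⟫_ℂ) ∧
      ⟪u, g⟫_ℂ * conj ⟪u, g⟫_ℂ + β * conj β = 1 ∧
      (∀ x, ⟪u, x⟫_ℂ = 0 → ⟪g, x⟫_ℂ = 0 → ⟪w, x⟫_ℂ = 0) := by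
  have huu : ⟪u, u⟫_ℂ = 1 := by simp [inner_self_eq_norm_sq_to_K, hu]
  have hgg : ⟪g, g⟫_ℂ = 1 := by simp [inner_self_eq_norm_sq_to_K, hg]
  have hconj : ⟪g, u⟫_ℂ = conj ⟪u, g⟫_ℂ := (inner_conj_symm g u).symm
  set z : E := g - ⟪u, g⟫_ℂ • u with hz
  have huz : ⟪u, z⟫_ℂ = 0 := by
    rw [hz, inner_sub_right, inner_smul_right, huu, mul_one, sub_self]
  have hzz : ⟪z, z⟫_ℂ = 1 - ⟪u, g⟫_ℂ * conj ⟪u, g⟫_ℂ := by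
    simp only [hz, inner_sub_right, inner_sub_left, inner_smul_right, inner_smul_left, huu, hgg,
      hconj]
    ring
  have hzx : ∀ x, ⟪u, x⟫_ℂ = 0 → ⟪g, x⟫_ℂ = 0 → ⟪z, x⟫_ℂ = 0 := fun x h1 h2 => by
    rw [hz, inner_sub_left, inner_smul_left, h1, h2, mul_zero, sub_zero]
  have hzn : ⟪z, z⟫_ℂ = (‖z‖ : ℂ) * ‖z‖ := by simp [inner_self_eq_norm_sq_to_K, sq]
  -- `e` is 0 if `g` is a multiple of `u` and 1 otherwise; carrying it lets one formula for the
  -- rotation cover both cases.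
  by_cases h0 : z = 0
  · refine ⟨0, 0, 0, ?_, by simp, by simp, by simp, by simp, ?_, by simp⟩
    · simpa [hz, sub_eq_zero] using h0
    · rw [h0, inner_zero_left] at hzz
      linear_combination hzz
  · have hn : (‖z‖ : ℂ) ≠ 0 := by simpa using h0
    refine ⟨(‖z‖ : ℂ)⁻¹ • z, ‖z‖, 1, ?_, ?_, ?_, by simp, by simp, ?_, ?_⟩
    · rw [smul_smul, mul_inv_cancel₀ hn, one_smul, hz, add_sub_cancel]
    · rw [inner_smul_right, huz, mul_zero]
    · rw [inner_smul_left, inner_smul_right, hzn]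
      simp only [map_inv₀, Complex.conj_ofReal]
      field_simp
    · rw [Complex.conj_ofReal, ← hzn, hzz]
      ring
    · intro x h1 h2
      rw [inner_smul_left, hzx x h1 h2, mul_zero]

/-- A unit vector can be carried to another one by an isometry that fixes everything orthogonal to
both and turns no vector by more than the angle between the two. -/
theorem exists_rotation (u g : E) (hu : ‖u‖ = 1) (hg : ‖g‖ = 1) :
    ∃ V : E →ₗᵢ[ℂ] E, V u = g ∧ (∀ x, ⟪u, x⟫_ℂ = 0 → ⟪g, x⟫_ℂ = 0 → V x = x) ∧
      ∀ x, x ≠ 0 → realAngle x (V x) ≤ realAngle u g := by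
  obtain ⟨w, β, e, hgdec, huw, hww, hβe, hew, hαβ, hfix⟩ :=
    exists_orthogonal_decomposition u g hu hg
  have huu : ⟪u, u⟫_ℂ = 1 := by simp [inner_self_eq_norm_sq_to_K, hu]
  have hwu : ⟪w, u⟫_ℂ = 0 := inner_eq_zero_symm.mp huw
  set α : ℂ := ⟪u, g⟫_ℂ with hα
  -- When `w ≠ 0`, `T` acts on the basis `u, w` by the `SU(2)` matrix with columns `(α, β)` and
  -- `(-conj β, conj α)`. Its diagonal entries share the real part `Re α`, which yields the angle
  -- bound.
  let T : E →ₗ[ℂ] E :=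
    { toFun := fun x => x + ((α - 1) * ⟪u, x⟫_ℂ - conj β * ⟪w, x⟫_ℂ) • u +
        (β * ⟪u, x⟫_ℂ + (conj α - 1) * ⟪w, x⟫_ℂ) • w
      map_add' := fun x y => by simp only [inner_add_right]; module
      map_smul' := fun c x => by
        simp only [inner_smul_right, RingHom.id_apply]; module }
  have hT : ∀ x, T x = x + ((α - 1) * ⟪u, x⟫_ℂ - conj β * ⟪w, x⟫_ℂ) • u +
        (β * ⟪u, x⟫_ℂ + (conj α - 1) * ⟪w, x⟫_ℂ) • w := fun x => rfl
  have hxu : ∀ x, ⟪x, u⟫_ℂ = conj ⟪u, x⟫_ℂ := fun x => (inner_conj_symm x u).symm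
  have hxw : ∀ x, ⟪x, w⟫_ℂ = conj ⟪w, x⟫_ℂ := fun x => (inner_conj_symm x w).symm
  have hself : ∀ x, ⟪T x, T x⟫_ℂ = ⟪x, x⟫_ℂ := fun x => by
    have h1 := hew x
    simp only [hT, inner_add_left, inner_add_right, inner_smul_left, inner_smul_right, huu, huw,
      hwu, hww, hxu x, hxw x, map_add, map_sub, map_mul, Complex.conj_conj, map_one]
    generalize ⟪u, x⟫_ℂ = a at *
    generalize ⟪w, x⟫_ℂ = p at *
    generalize conj a = a' at *
    generalize conj p = p' at *
    generalize conj α = α' at *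
    generalize conj β = β' at *
    linear_combination (a * a' + p * p') * hαβ
      + (β' * a' * a + (α - 1) * p' * a) * hβe
      + (β' * a' * (α' - 1) + (α - 1) * p' * (α' - 1)) * h1
  -- The cross terms form a number minus its conjugate, so they drop out of the real part.
  have hinner : ∀ x, ⟪x, T x⟫_ℂ = ⟪x, x⟫_ℂ + (α - 1) * (⟪u, x⟫_ℂ * conj ⟪u, x⟫_ℂ) +
      (conj α - 1) * (⟪w, x⟫_ℂ * conj ⟪w, x⟫_ℂ) + (β * ⟪u, x⟫_ℂ * conj ⟪w, x⟫_ℂ -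
        conj (β * ⟪u, x⟫_ℂ * conj ⟪w, x⟫_ℂ)) := fun x => by
    simp only [hT, inner_add_right, inner_smul_right, hxu x, hxw x, map_mul, Complex.conj_conj]
    ring
  have hbessel : ∀ x, Complex.normSq ⟪u, x⟫_ℂ + Complex.normSq ⟪w, x⟫_ℂ ≤ ‖x‖ ^ 2 := fun x => by
    have h : ⟪x - ⟪u, x⟫_ℂ • u - ⟪w, x⟫_ℂ • w,
        x - ⟪u, x⟫_ℂ • u - ⟪w, x⟫_ℂ • w⟫_ℂ =
        ⟪x, x⟫_ℂ - ⟪u, x⟫_ℂ * conj ⟪u, x⟫_ℂ - ⟪w, x⟫_ℂ * conj ⟪w, x⟫_ℂ := by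
      have h1 := hew x
      simp only [inner_sub_left, inner_sub_right, inner_smul_left, inner_smul_right, huu, huw,
        hwu, hww, hxu x, hxw x]
      linear_combination (conj ⟪w, x⟫_ℂ) * h1
    rw [Complex.mul_conj, Complex.mul_conj, inner_self_eq_norm_sq_to_K,
      inner_self_eq_norm_sq_to_K] at h
    have h' : ‖x - ⟪u, x⟫_ℂ • u - ⟪w, x⟫_ℂ • w‖ ^ 2 =
        ‖x‖ ^ 2 - Complex.normSq ⟪u, x⟫_ℂ - Complex.normSq ⟪w, x⟫_ℂ := by
      apply Complex.ofReal_injective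
      push_cast
      exact h
    nlinarith [sq_nonneg ‖x - ⟪u, x⟫_ℂ • u - ⟪w, x⟫_ℂ • w‖]
  have hnorm : ∀ x, ‖T x‖ = ‖x‖ := fun x => by
    rw [@norm_eq_sqrt_re_inner ℂ, @norm_eq_sqrt_re_inner ℂ, hself]
  refine ⟨⟨T, hnorm⟩, ?_, ?_, ?_⟩
  · change T u = g
    rw [hT, huu, hwu, hgdec]
    module
  · intro x h1 h2
    change T x = x
    rw [hT, h1, hfix x h1 h2]
    simp
  · intro x hx
    change realAngle x (T x) ≤ realAngle u g
    have hx' : 0 < ‖x‖ := norm_pos_iff.mpr hx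
    apply Real.arccos_le_arccos
    rw [hu, hg, hnorm, ← hα, hinner]
    have hα1 : α.re ≤ 1 := by
      refine (Complex.re_le_norm α).trans ?_
      simpa [hu, hg] using norm_inner_le_norm (𝕜 := ℂ) u g
    rw [le_div_iff₀ (by positivity), Complex.mul_conj, Complex.mul_conj,
      inner_self_eq_norm_sq_to_K]
    have hx2 : ((‖x‖ : ℂ) ^ 2).re = ‖x‖ ^ 2 := by norm_cast
    simp only [Complex.add_re, Complex.sub_re, Complex.conj_re,
      Complex.re_mul_ofReal, Complex.one_re, sub_self, add_zero, Complex.coe_algebraMap, hx2]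
    -- What remains is `(1 - Re α) * (‖x‖² - |⟪u, x⟫|² - |⟪w, x⟫|²) ≥ 0`.
    nlinarith [hbessel x]

/-- The composition of rotations for two orthonormal families in triangular position. -/
theorem exists_isometry_of_triangular {k : ℕ} (u g : Fin k → E) (hu : Orthonormal ℂ u)
    (hg : Orthonormal ℂ g) (hug : ∀ i j, j < i → ⟪u i, g j⟫_ℂ = 0) :
    ∃ V : E →ₗᵢ[ℂ] E, (∀ i, V (u i) = g i) ∧
      (∀ x, (∀ i, ⟪u i, x⟫_ℂ = 0) → (∀ i, ⟪g i, x⟫_ℂ = 0) → V x = x) ∧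
      ∀ x, x ≠ 0 → realAngle x (V x) ≤ ∑ i, realAngle (u i) (g i) := by
  induction k with
  | zero =>
    exact ⟨LinearIsometry.id, fun i => i.elim0, by simp, fun x hx => by simp [realAngle_self hx]⟩
  | succ k ih =>
    obtain ⟨V, hV, hVfix, hVang⟩ := ih (fun i => u i.castSucc) (fun i => g i.castSucc)
      (hu.comp _ (Fin.castSucc_injective k)) (hg.comp _ (Fin.castSucc_injective k))
      (fun i j hij => hug _ _ (by simpa using hij))
    obtain ⟨S, hS, hSfix, hSang⟩ := exists_rotation (u (Fin.last k)) (g (Fin.last k))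
      (hu.1 _) (hg.1 _)
    refine ⟨S.comp V, ?_, ?_, ?_⟩
    · intro i
      refine Fin.lastCases ?_ (fun i => ?_) i
      -- The last `u` is orthogonal to all earlier `u i` and `g i`, so `V` fixes it before `S` moves
      -- it.
      · change S (V _) = _
        rw [hVfix, hS]
        · exact fun i => hu.2 (Fin.castSucc_lt_last i).ne
        · exact fun i => inner_eq_zero_symm.mp (hug _ _ (Fin.castSucc_lt_last i))
      -- An earlier `g i` is orthogonal to the last `u` and the last `g`, so `S` leaves it in place.
      · change S (V _) = _
        rw [hV, hSfix]
        · exact hug _ _ (Fin.castSucc_lt_last i)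
        · exact hg.2 (Fin.castSucc_lt_last i).ne'
    · intro x h1 h2
      change S (V _) = _
      rw [hVfix x (fun i => h1 _) (fun i => h2 _),
        hSfix x (h1 _) (h2 _)]
    · intro x hx
      rw [Fin.sum_univ_castSucc]
      refine (realAngle_le_add x (V x) (S (V x))).trans (add_le_add (hVang x hx) ?_)
      exact hSang _ ((map_ne_zero_iff V V.injective).mpr hx)

/-- Schur triangularisation. -/
theorem exists_orthonormal_triangular {n : ℕ} [FiniteDimensional ℂ E]
    (hn : Module.finrank ℂ E = n) (T : E →ₗ[ℂ] E) :
    ∃ b : Fin n → E, Orthonormal ℂ b ∧ ∀ i j, j < i → ⟪b i, T (b j)⟫_ℂ = 0 := by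
  induction n generalizing E with
  | zero => exact ⟨fun i => i.elim0, ⟨fun i => i.elim0, fun i => i.elim0⟩, fun i => i.elim0⟩
  | succ n ih =>
    have : Nontrivial E := Module.nontrivial_of_finrank_pos (R := ℂ) (by omega)
    obtain ⟨μ, hμ⟩ := Module.End.exists_eigenvalue T
    obtain ⟨x, hx⟩ := hμ.exists_hasEigenvector
    have hx0 : (‖x‖ : ℂ) ≠ 0 := by simpa using hx.2
    set u : E := (‖x‖ : ℂ)⁻¹ • x with hu
    have hu1 : ‖u‖ = 1 := norm_smul_inv_norm hx.2
    have hTu : T u = μ • u := by rw [hu, map_smul, hx.apply_eq_smul, smul_comm]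
    have hu0 : u ≠ 0 := by rintro h; simp [h] at hu1
    have : Fact (Module.finrank ℂ E = n + 1) := ⟨hn⟩
    let K : Submodule ℂ E := (ℂ ∙ u)ᗮ
    have hK : Module.finrank ℂ K = n := Submodule.finrank_orthogonal_span_singleton hu0
    -- `K` need not be `T`-invariant: the compression suffices, since pairing with `b i ∈ K` sees
    -- only the projection to `K`.
    obtain ⟨b, hb, hbT⟩ := ih hK (K.orthogonalProjectionOnto.toLinearMap ∘ₗ T ∘ₗ K.subtype)
    have hub : ∀ i, ⟪u, (b i : E)⟫_ℂ = 0 := fun i =>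
      Submodule.mem_orthogonal_singleton_iff_inner_right.mp (b i).2
    refine ⟨Fin.cons u fun i => (b i : E), ⟨?_, ?_⟩, ?_⟩
    · intro i
      refine Fin.cases hu1 (fun i => ?_) i
      simpa using hb.1 i
    · intro i j hij
      induction i using Fin.cases with
      | zero => induction j using Fin.cases with
        | zero => exact absurd rfl hij
        | succ j => simpa using hub j
      | succ i => induction j using Fin.cases with
        | zero => simpa using inner_eq_zero_symm.mp (hub i)
        | succ j => simpa using hb.2 (fun h => hij (by rw [h]) : i ≠ j)
    · intro i j hij
      induction i using Fin.cases with
      | zero => exact absurd hij (Fin.not_lt_zero _)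
      | succ i => induction j using Fin.cases with
        | zero => simp [hTu, inner_eq_zero_symm.mp (hub i)]
        | succ j =>
          have := hbT i j (by simpa using hij)
          simpa using this

end Rotation

/-! ### Unitary completion of an isometry -/

section Columns

/-- The columns of a matrix, as vectors of a Euclidean space. -/
def euclideanCol {R K : Type*} (A : Matrix R K ℂ) (k : K) : EuclideanSpace ℂ R :=
  WithLp.toLp 2 (A.col k)

variable {R K L : Type*} [Fintype R]

lemma inner_euclideanCol (A : Matrix R K ℂ) (B : Matrix R L ℂ) (i : K) (j : L) :
    ⟪euclideanCol A i, euclideanCol B j⟫_ℂ = (A.conjTranspose * B) i j := by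
  simp [euclideanCol, PiLp.inner_apply, Matrix.mul_apply, mul_comm]

lemma orthonormal_euclideanCol_iff [DecidableEq K] (A : Matrix R K ℂ) :
    Orthonormal ℂ (euclideanCol A) ↔ A.conjTranspose * A = 1 := by
  simp only [orthonormal_iff_ite, inner_euclideanCol, ← Matrix.ext_iff, Matrix.one_apply]

lemma realAngle_euclideanCol [DecidableEq K] {A B : Matrix R K ℂ}
    (hA : A.conjTranspose * A = 1) (hB : B.conjTranspose * B = 1) (i : K) :
    realAngle (euclideanCol A i) (euclideanCol B i) =
      Real.arccos ((A.conjTranspose * B) i i).re := by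
  rw [realAngle, ((orthonormal_euclideanCol_iff A).mpr hA).1,
    ((orthonormal_euclideanCol_iff B).mpr hB).1, inner_euclideanCol, mul_one, div_one]

variable [DecidableEq R]

lemma exists_unitary_of_isometry (V : EuclideanSpace ℂ R →ₗᵢ[ℂ] EuclideanSpace ℂ R) :
    ∃ A ∈ Matrix.unitaryGroup R ℂ, ∀ x : EuclideanSpace ℂ R, Matrix.toEuclideanLin A x = V x := by
  obtain ⟨A, h⟩ : ∃ A : Matrix R R ℂ, ∀ x, Matrix.toEuclideanLin A x = V x :=
    ⟨Matrix.toEuclideanLin.symm V.toLinearMap, fun x => by simp⟩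
  refine ⟨A, ?_, h⟩
  rw [Matrix.mem_unitaryGroup_iff', Matrix.star_eq_conjTranspose, ← orthonormal_euclideanCol_iff]
  convert! (EuclideanSpace.basisFun R ℂ).orthonormal.comp_linearIsometry V using 1
  ext i : 1
  rw [Function.comp_apply, ← h, EuclideanSpace.basisFun_apply]
  ext r
  simp [euclideanCol]

lemma unitaryMaxNorm_nonneg (U : Matrix R R ℂ) : 0 ≤ unitaryMaxNorm U :=
  Real.sSup_nonneg (by rintro _ ⟨θ, -, rfl⟩; exact abs_nonneg θ)

/-- An eigenvector for `exp (-iθ)` is turned by `arccos (cos θ) = |θ|`, because `|θ| ≤ π`. The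
condition `0 ≤ s` covers an empty set of eigenangles, whose `sSup` is 0. -/
lemma unitaryMaxNorm_le {A : Matrix R R ℂ} {s : ℝ} (hs : 0 ≤ s)
    (h : ∀ x : EuclideanSpace ℂ R, x ≠ 0 → realAngle x (Matrix.toEuclideanLin A x) ≤ s) :
    unitaryMaxNorm A ≤ s := by
  refine Real.sSup_le ?_ hs
  rintro _ ⟨θ, ⟨hθ, hev⟩, rfl⟩
  obtain ⟨y, hy⟩ := hev.exists_hasEigenvector
  set x : EuclideanSpace ℂ R := WithLp.toLp 2 y with hx
  have hx0 : x ≠ 0 := by simpa [hx] using hy.2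
  have hAx : Matrix.toEuclideanLin A x = Complex.exp (-(Complex.I * θ)) • x := by
    rw [hx, Matrix.toLpLin_toLp, hy.apply_eq_smul, WithLp.toLp_smul]
  have hexp : Complex.exp (-(Complex.I * θ)) = Complex.exp ((-θ : ℝ) * Complex.I) := by
    congr 1; push_cast; ring
  have hn : ‖Complex.exp (-(Complex.I * θ)) • x‖ = ‖x‖ := by
    rw [norm_smul, hexp, Complex.norm_exp_ofReal_mul_I, one_mul]
  have hin : (⟪x, Complex.exp (-(Complex.I * θ)) • x⟫_ℂ).re = Real.cos θ * (‖x‖ * ‖x‖) := by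
    have hself : ⟪x, x⟫_ℂ = ((‖x‖ ^ 2 : ℝ) : ℂ) := by
      rw [inner_self_eq_norm_sq_to_K]
      push_cast
      rfl
    rw [inner_smul_right, hself, hexp, ← sq, Complex.re_mul_ofReal, Complex.exp_ofReal_mul_I_re,
      Real.cos_neg]
  have hx1 : ‖x‖ * ‖x‖ ≠ 0 := by simpa using hx0
  have := h x hx0
  rwa [hAx, realAngle, hn, hin, mul_div_cancel_right₀ _ hx1, ← Real.cos_abs,
    Real.arccos_cos (abs_nonneg θ) (abs_le.mpr ⟨hθ.1.le, hθ.2⟩)] at this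

lemma partialMaxNorm_nonneg (c : K → R) (G : Matrix R K ℂ) : 0 ≤ partialMaxNorm c G :=
  Real.sInf_nonneg (by rintro _ ⟨V, -, -, rfl⟩; exact unitaryMaxNorm_nonneg V)

/-- Schur triangularisation by a unitary matrix. -/
theorem exists_unitary_triangular {n : ℕ} (M : Matrix (Fin n) (Fin n) ℂ) :
    ∃ Q ∈ Matrix.unitaryGroup (Fin n) ℂ, (Q.conjTranspose * M * Q).IsUpperTriangular := by
  obtain ⟨b, hb, hbT⟩ := exists_orthonormal_triangular (n := n)
    (by simp : Module.finrank ℂ (EuclideanSpace ℂ (Fin n)) = n) (Matrix.toEuclideanLin M)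
  let Q : Matrix (Fin n) (Fin n) ℂ := Matrix.of fun r k => b k r
  have hQ : euclideanCol Q = b := rfl
  have hMQ : ∀ j, euclideanCol (M * Q) j = Matrix.toEuclideanLin M (b j) := fun j => rfl
  refine ⟨Q, ?_, ?_⟩
  · rwa [Matrix.mem_unitaryGroup_iff', Matrix.star_eq_conjTranspose, ← orthonormal_euclideanCol_iff]
  · intro i j hij
    rw [Matrix.mul_assoc, ← inner_euclideanCol, hMQ]
    exact hbT i j hij

lemma sumArccosEigenvalues_of_triangular {n : ℕ} {M Q : Matrix (Fin n) (Fin n) ℂ}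
    (hQ : Q ∈ Matrix.unitaryGroup (Fin n) ℂ) (h : (Q.conjTranspose * M * Q).IsUpperTriangular) :
    sumArccosEigenvalues M = ∑ i, Real.arccos ((Q.conjTranspose * M * Q) i i).re := by
  have hchar : (Q.conjTranspose * M * Q).charpoly = M.charpoly := by
    rw [Matrix.charpoly_mul_comm, ← Matrix.mul_assoc, ← Matrix.star_eq_conjTranspose,
      Matrix.mem_unitaryGroup_iff.mp hQ, Matrix.one_mul]
  rw [sumArccosEigenvalues, ← hchar, Matrix.charpoly_of_isUpperTriangular _ h,
    show ∏ i, (Polynomial.X - Polynomial.C ((Q.conjTranspose * M * Q) i i)) =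
      ((Finset.univ.val.map fun i => (Q.conjTranspose * M * Q) i i).map
        fun a => Polynomial.X - Polynomial.C a).prod by rw [Multiset.map_map]; rfl,
    Polynomial.roots_multiset_prod_X_sub_C, Multiset.map_map]
  rfl

/-- An isometry whose rows at the positions `c` form `M` has a unitary completion of max
time-energy at most `∑ i, arccos (Re (λ_i M))`. -/
theorem partialMaxNorm_le {n : ℕ} {c : Fin n → R} (hc : Function.Injective c)
    {G : Matrix R (Fin n) ℂ} (hG : G.conjTranspose * G = 1) :
    partialMaxNorm c G ≤ sumArccosEigenvalues (G.submatrix c id) := by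
  set M := G.submatrix c id with hM
  obtain ⟨Q, hQ, hT⟩ := exists_unitary_triangular M
  rw [sumArccosEigenvalues_of_triangular hQ hT]
  have hQQ : Q.conjTranspose * Q = 1 := Matrix.mem_unitaryGroup_iff'.mp hQ
  have hQQ' : Q * Q.conjTranspose = 1 := Matrix.mem_unitaryGroup_iff.mp hQ
  -- `A * J` selects the columns of `A` at the positions `c`, and `J† * G` the rows of `G` there.
  set J : Matrix R (Fin n) ℂ := (1 : Matrix R R ℂ).submatrix id c with hJ
  have hJG : J.conjTranspose * G = M := by
    ext i j
    simp [hJ, hM, Matrix.mul_apply, Matrix.one_apply]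
  have hJJ : J.conjTranspose * J = 1 := by
    ext i j
    simp [hJ, Matrix.mul_apply, Matrix.one_apply, hc.eq_iff]
  have hcol : ∀ {B : Matrix R (Fin n) ℂ}, B.conjTranspose * B = 1 →
      (B * Q).conjTranspose * (B * Q) = 1 := fun {B} hB => by
    rw [Matrix.conjTranspose_mul, Matrix.mul_assoc, ← Matrix.mul_assoc _ B, hB, Matrix.one_mul, hQQ]
  have hcross : (J * Q).conjTranspose * (G * Q) = Q.conjTranspose * M * Q := by
    rw [Matrix.conjTranspose_mul, Matrix.mul_assoc, ← Matrix.mul_assoc _ G, hJG, Matrix.mul_assoc]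
  obtain ⟨V, hV, -, hVang⟩ := exists_isometry_of_triangular (euclideanCol (J * Q))
    (euclideanCol (G * Q)) ((orthonormal_euclideanCol_iff _).mpr (hcol hJJ))
    ((orthonormal_euclideanCol_iff _).mpr (hcol hG)) (fun i j hij => by
      rw [inner_euclideanCol, hcross]
      exact hT hij)
  obtain ⟨A, hA, hAV⟩ := exists_unitary_of_isometry V
  have hAJ : A * J = G := by
    have h : A * (J * Q) = G * Q := by
      ext r k
      have := congrArg (fun x : EuclideanSpace ℂ R => x r) ((hAV _).trans (hV k))
      exact this
    calc A * J = A * (J * Q) * Q.conjTranspose := by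
          rw [Matrix.mul_assoc, Matrix.mul_assoc, hQQ', Matrix.mul_one]
      _ = G := by rw [h, Matrix.mul_assoc, hQQ', Matrix.mul_one]
  have hAc : A.submatrix id c = G := by
    rw [← hAJ]
    ext r k
    simp [hJ, Matrix.mul_apply, Matrix.one_apply]
  have hle : partialMaxNorm c G ≤ unitaryMaxNorm A := by
    refine csInf_le ⟨0, ?_⟩ ⟨A, hA, hAc, rfl⟩
    rintro _ ⟨V, -, -, rfl⟩
    exact unitaryMaxNorm_nonneg V
  refine hle.trans <| unitaryMaxNorm_le
    (Finset.sum_nonneg fun i _ => Real.arccos_nonneg _) fun x hx => ?_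
  rw [hAV]
  refine (hVang x hx).trans_eq (Finset.sum_congr rfl fun i _ => ?_)
  rw [realAngle_euclideanCol (hcol hJJ) (hcol hG), hcross]

/-- Every unit vector is a row of a unitary matrix. -/
lemma exists_unitary_row (r : R) (g : EuclideanSpace ℂ R) (hg : ‖g‖ = 1) :
    ∃ W ∈ Matrix.unitaryGroup R ℂ, ∀ j, W r j = g j := by
  obtain ⟨V, hV, -⟩ := exists_rotation (EuclideanSpace.single r (1 : ℂ)) g (by simp) hg
  obtain ⟨A, hA, hAV⟩ := exists_unitary_of_isometry V
  -- `g` is column `r` of `A`; the plain transpose makes it a row without conjugation.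
  refine ⟨A.transpose, Matrix.transpose_mem_unitaryGroup_iff.mpr hA, fun j => ?_⟩
  rw [← hV, ← hAV]
  simp [Matrix.toLpLin_apply]

end Columns

/-! ### The bound for a fixed `v` -/

section Channel

variable {n d : ℕ} (F : Fin d → Matrix (Fin n) (Fin n) ℂ)

lemma conjTranspose_stack_mul_stack (hF : IsKraus F) :
    (stack (d + 1) F).conjTranspose * stack (d + 1) F = 1 := by
  rw [← (hF : ∑ j, (F j).conjTranspose * F j = 1)]
  ext i k
  simp [Matrix.mul_apply, Matrix.sum_apply, Fintype.sum_prod_type, Fin.sum_univ_castSucc, stack]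

lemma channelMaxNorm_le (hF : IsKraus F) (v : EuclideanSpace ℂ (Fin d)) (hv : ‖v‖ ≤ 1) :
    channelMaxNorm F ≤ sumArccosEigenvalues (∑ j, v j • F j) := by
  -- The last coordinate brings the norm up to 1 and multiplies only the zero block, so it does not
  -- affect the top block of `G`.
  let g : EuclideanSpace ℂ (Fin (d + 1)) :=
    WithLp.toLp 2 (Fin.snoc (α := fun _ => ℂ) v ((Real.sqrt (1 - ‖v‖ ^ 2) : ℝ) : ℂ))
  have hg1 : ∀ j : Fin d, g j.castSucc = v j := fun j => by simp [g]
  have hg2 : g (Fin.last d) = ((Real.sqrt (1 - ‖v‖ ^ 2) : ℝ) : ℂ) := by simp [g]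
  have hg : ‖g‖ = 1 := by
    have h0 : (0 : ℝ) ≤ 1 - ‖v‖ ^ 2 := by nlinarith [norm_nonneg v]
    have h1 : ‖g‖ ^ 2 = 1 := by
      rw [EuclideanSpace.norm_sq_eq, Fin.sum_univ_castSucc, hg2, Complex.norm_real, Real.norm_eq_abs,
        sq_abs, Real.sq_sqrt h0, EuclideanSpace.norm_sq_eq v]
      simp only [hg1]
      ring
    nlinarith [norm_nonneg g]
  obtain ⟨W, hW, hWg⟩ := exists_unitary_row 0 g hg
  set G := (W ⊗ₖ (1 : Matrix (Fin n) (Fin n) ℂ)) * stack (d + 1) F with hGdef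
  have hG : G.conjTranspose * G = 1 := by
    rw [hGdef, Matrix.conjTranspose_mul, Matrix.mul_assoc,
      ← Matrix.mul_assoc _ (W ⊗ₖ (1 : Matrix (Fin n) (Fin n) ℂ)), Matrix.conjTranspose_kronecker,
      ← Matrix.mul_kronecker_mul, ← Matrix.star_eq_conjTranspose W,
      Matrix.mem_unitaryGroup_iff'.mp hW, Matrix.conjTranspose_one, Matrix.one_mul,
      Matrix.one_kronecker_one, Matrix.one_mul, conjTranspose_stack_mul_stack F hF]
  have htop : G.submatrix (fun k : Fin n => ((0 : Fin (d + 1)), k)) id = ∑ j, v j • F j := by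
    ext a k
    simp [hGdef, Matrix.mul_apply, Matrix.sum_apply, Fintype.sum_prod_type, Fin.sum_univ_castSucc,
      stack, Matrix.one_apply, hWg, hg1]
  rw [← htop]
  have hle : channelMaxNorm F ≤ partialMaxNorm (fun k : Fin n => ((0 : Fin (d + 1)), k)) G := by
    refine csInf_le ⟨0, ?_⟩ ⟨d, Nat.le_succ d, W, hW, rfl⟩
    rintro _ ⟨m, -, W, -, rfl⟩
    exact partialMaxNorm_nonneg _ _
  exact hle.trans (partialMaxNorm_le (fun _ _ h => (Prod.ext_iff.mp h).2) hG)

end Channel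

/-! ### Attainment of the minimum -/

section Minimum

lemma isCompact_unitaryGroup (n : ℕ) :
    IsCompact (Matrix.unitaryGroup (Fin n) ℂ : Set (Matrix (Fin n) (Fin n) ℂ)) := by
  have hbox : IsCompact (Set.univ.pi fun _ : Fin n => Set.univ.pi fun _ : Fin n =>
      Metric.closedBall (0 : ℂ) 1) :=
    isCompact_univ_pi fun _ => isCompact_univ_pi fun _ => isCompact_closedBall 0 1
  have hclosed : IsClosed
      (Matrix.unitaryGroup (Fin n) ℂ : Set (Matrix (Fin n) (Fin n) ℂ)) := isClosed_unitary
  refine hbox.of_isClosed_subset hclosed fun U hU i _ j _ => ?_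
  simpa using entry_norm_bound_of_unitary hU i j

/-- Continuity of eigenvalues is avoided: by Schur, the values are those of a continuous function of
the diagonal of `Q† M Q`, over the compact set of pairs `(v, Q)` for which this matrix is upper
triangular. -/
theorem exists_isLeast_sumArccosEigenvalues {n d : ℕ} (F : Fin d → Matrix (Fin n) (Fin n) ℂ) :
    ∃ b : ℝ, IsLeast ((fun v : EuclideanSpace ℂ (Fin d) =>
      sumArccosEigenvalues (∑ j, v j • F j)) '' {v | ‖v‖ ≤ 1}) b := by
  let T : EuclideanSpace ℂ (Fin d) × Matrix (Fin n) (Fin n) ℂ → Matrix (Fin n) (Fin n) ℂ :=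
    fun p => p.2.conjTranspose * (∑ j, p.1 j • F j) * p.2
  have hT : Continuous T := by fun_prop
  let S : Set (EuclideanSpace ℂ (Fin d) × Matrix (Fin n) (Fin n) ℂ) :=
    (Metric.closedBall 0 1 ×ˢ (Matrix.unitaryGroup (Fin n) ℂ : Set _)) ∩
      {p | (T p).IsUpperTriangular}
  have hclosed : IsClosed {p | (T p).IsUpperTriangular} := by
    simp only [Matrix.IsUpperTriangular, Matrix.BlockTriangular, Set.ofPred_forall]
    refine isClosed_iInter fun i => isClosed_iInter fun j => isClosed_iInter fun _ => ?_
    exact isClosed_eq (hT.matrix_elem i j) continuous_const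
  have hS : IsCompact S :=
    ((isCompact_closedBall _ _).prod (isCompact_unitaryGroup n)).inter_right hclosed
  let f : EuclideanSpace ℂ (Fin d) × Matrix (Fin n) (Fin n) ℂ → ℝ :=
    fun p => ∑ i, Real.arccos ((T p) i i).re
  have hf : Continuous f := continuous_finsetSum _ fun i _ =>
    Real.continuous_arccos.comp (Complex.continuous_re.comp (hT.matrix_elem i i))
  have himage : (fun v : EuclideanSpace ℂ (Fin d) =>
      sumArccosEigenvalues (∑ j, v j • F j)) '' {v | ‖v‖ ≤ 1} = f '' S := by
    ext x
    constructor
    · rintro ⟨v, hv, rfl⟩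
      obtain ⟨Q, hQ, hQT⟩ := exists_unitary_triangular (∑ j, v j • F j)
      exact ⟨(v, Q), ⟨⟨mem_closedBall_zero_iff.mpr hv, hQ⟩, hQT⟩,
        (sumArccosEigenvalues_of_triangular hQ hQT).symm⟩
    · rintro ⟨⟨v, Q⟩, ⟨⟨hv, hQ⟩, hQT⟩, rfl⟩
      exact ⟨v, mem_closedBall_zero_iff.mp hv, sumArccosEigenvalues_of_triangular hQ hQT⟩
  rw [himage]
  refine (hS.image hf).exists_isLeast ?_
  rw [← himage]
  exact ⟨_, 0, by simp, rfl⟩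

end Minimum

end TimeEnergy

theorem mainTheorem2 (n d : ℕ) (F : Fin d → Matrix (Fin n) (Fin n) ℂ)
    (hF : TimeEnergy.IsKraus F) :
    ∃ b : ℝ,
      IsLeast ((fun v : EuclideanSpace ℂ (Fin d) =>
        TimeEnergy.sumArccosEigenvalues (∑ j, v j • F j)) '' {v | ‖v‖ ≤ 1}) b ∧
      TimeEnergy.channelMaxNorm F ≤ b := by
  obtain ⟨b, hb⟩ := TimeEnergy.exists_isLeast_sumArccosEigenvalues F
  refine ⟨b, hb, ?_⟩
  obtain ⟨v, hv, rfl⟩ := hb.1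
  exact TimeEnergy.channelMaxNorm_le F hF v hv
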